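/- **Theorem 1 (Privacy performance of ACFL).** Let $N,d,o$ be natural numbers, let $m_1,\dots,m_N$ be natural numbers, and let $\sigma_1,\sigma_2>0$. Device $i\in\{1,\dots,N\}$ holds a local dataset $(X,Y)$ with $X\in\mathbb R^{m_i\times d}$ (samples) and $Y\in\mathbb R^{m_i\times o}$ (labels), all of whose entries have absolute value at most $1$. It uploads the coded dataset $$q(X,Y)=(H_X,H_Y)=\bigl(X^{T}X+N_1,\;X^{T}Y+N_2\bigr),$$ where $N_1\in\mathbb R^{d\times d}$ has i.i.d. $\mathcal N(0,\sigma_1^2)$ entries, $N_2\in\mathbb R^{d\times o}$ has i.i.d. $\mathcal N(0,\sigma_2^2)$ entries, and $N_1$, $N_2$ and the data $(X,Y)$ are independent. Then, for every device $i$, the coded dataset satisfies $\epsilon$-mutual-information differential privacy with respect to the entries of $X$, that is, $$\sup_{j,k,\;p(X,Y)} I\bigl(X_{j,k};\,H_X,H_Y \,\big|\, X^{-j,k},\,Y\bigr)\le\epsilon,\qquad \epsilon=\Bigl(d-\tfrac12\Bigr)\log\frac{1+\sigma_1^2}{\sigma_1^2}+\frac o2\log\frac{1+\sigma_2^2}{\sigma_2^2}.$$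 Here the supremum is over all positions $(j,k)$ of $X$ and all joint probability distributions $p(X,Y)$ of datasets with entries in $[-1,1]$; $X^{-j,k}$ denotes the entries of $X$ other than $X_{j,k}$; $\log$ is the natural logarithm; and $I(U;V\mid W)$ is the conditional mutual information in nats, i.e. the Kullback-Leibler divergence of the joint law of $(W,U,V)$ from the law under which $U$ and $V$ have the same conditional laws given $W$ but are conditionally independent given $W$. -/

import Mathlib

open MeasureTheory ProbabilityTheory
open scoped ENNReal NNReal Matrix

/-- Real matrices carry the product (Borel) σ-algebra of their entries. -/
instance Matrix.measurableSpaceEntries (a b : Type*) : MeasurableSpace (Matrix a b ℝ) :=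
  inferInstanceAs (MeasurableSpace (a → b → ℝ))

instance Matrix.standardBorelSpaceEntries (a b : Type*) [Countable a] [Countable b] :
    StandardBorelSpace (Matrix a b ℝ) :=
  inferInstanceAs (StandardBorelSpace (a → b → ℝ))

/-- Conditional mutual information `I(U; V | W)` (in nats) of random variables on `(Ω, μ)`:
the Kullback-Leibler divergence of the joint law of `(W, (U, V))` from
`P_W ⊗ (P_{U|W} × P_{V|W})`, the law under which `U` and `V` keep their conditional
distributions given `W` but are conditionally independent. -/
noncomputable def condMutualInfo {Ω α β γ : Type*} [MeasurableSpace Ω]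
    [MeasurableSpace α] [StandardBorelSpace α] [Nonempty α]
    [MeasurableSpace β] [StandardBorelSpace β] [Nonempty β] [MeasurableSpace γ]
    (U : Ω → α) (V : Ω → β) (W : Ω → γ) (μ : Measure Ω) [IsFiniteMeasure μ] : ℝ≥0∞ :=
  InformationTheory.klDiv
    (μ.map (fun ω => (W ω, (U ω, V ω))))
    ((μ.map W) ⊗ₘ (condDistrib U W μ ×ₖ condDistrib V W μ))

/-- All the entries of a matrix except the entry `(j, k)`. -/
def otherEntries {m n : ℕ} (Z : Matrix (Fin m) (Fin n) ℝ) (j : Fin m) (k : Fin n) :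
    {e : Fin m × Fin n // e ≠ (j, k)} → ℝ :=
  fun e => Z e.1.1 e.1.2

/-- `ε`-mutual-information differential privacy of a randomized function `q` for the entries of
a matrix `Z`, in the presence of further data `y : γ`.  The randomness of `q` is a
probability space `(Ω, P)`, drawn independently of the data.  The supremum runs over all entries
`(j, k)` of `Z` and over all joint distributions `p` of `(Z, y)` on the set `S` of admissible data;
the adversary knows every entry of `Z` other than `Z j k`, and all of `y`. -/
def IsMIDP {Ω γ δ : Type*} [MeasurableSpace Ω] [MeasurableSpace γ]
    [MeasurableSpace δ] [StandardBorelSpace δ] [Nonempty δ] {m n : ℕ}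
    (P : Measure Ω) [IsProbabilityMeasure P]
    (S : Set (Matrix (Fin m) (Fin n) ℝ × γ))
    (q : Matrix (Fin m) (Fin n) ℝ × γ → Ω → δ) (ε : ℝ) : Prop :=
  (⨆ (p : ProbabilityMeasure (Matrix (Fin m) (Fin n) ℝ × γ))
      (_ : ∀ᵐ z ∂(p : Measure (Matrix (Fin m) (Fin n) ℝ × γ)), z ∈ S)
      (j : Fin m) (k : Fin n),
    condMutualInfo
      (fun t : (Matrix (Fin m) (Fin n) ℝ × γ) × Ω => t.1.1 j k)
      (fun t => q t.1 t.2)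
      (fun t => (otherEntries t.1.1 j k, t.1.2))
      ((p : Measure (Matrix (Fin m) (Fin n) ℝ × γ)).prod P)) ≤ ENNReal.ofReal ε

/-- The local datasets `(X, Y)` all of whose entries have absolute value at most `1`. -/
def boundedData (m d o : ℕ) :
    Set (Matrix (Fin m) (Fin d) ℝ × Matrix (Fin m) (Fin o) ℝ) :=
  {z | (∀ j k, |z.1 j k| ≤ 1) ∧ (∀ j k, |z.2 j k| ≤ 1)}

/-- The encoder of adaptive coded federated learning with additive noises `N₁`, `N₂`:
the dataset `(X, Y)` is sent to `(Xᵀ X + N₁, Xᵀ Y + N₂)`. -/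
def acflEncode {Ω : Type*} {m d o : ℕ}
    (N₁ : Ω → Matrix (Fin d) (Fin d) ℝ) (N₂ : Ω → Matrix (Fin d) (Fin o) ℝ)
    (z : Matrix (Fin m) (Fin d) ℝ × Matrix (Fin m) (Fin o) ℝ) (ω : Ω) :
    Matrix (Fin d) (Fin d) ℝ × Matrix (Fin d) (Fin o) ℝ :=
  (z.1ᵀ * z.1 + N₁ ω, z.1ᵀ * z.2 + N₂ ω)

/-- A random matrix with i.i.d. entries of law `𝒩(0, v)`. -/
structure IsGaussianNoise {Ω : Type*} [MeasurableSpace Ω] {a b : ℕ}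
    (N : Ω → Matrix (Fin a) (Fin b) ℝ) (v : ℝ≥0) (P : Measure Ω) : Prop where
  hasLaw : ∀ j k, HasLaw (fun ω => N ω j k) (gaussianReal 0 v) P
  indep : iIndepFun (fun (e : Fin a × Fin b) ω => N ω e.1 e.2) P

/-!
The bound rests on the variational description of mutual information: for *every* kernel `Q` from
the conditioning variable to the output, `I(U; V | W)` is at most the divergence of the joint law of
`(W, U, V)` from the law under which `V` is drawn from `Q W` (`condMutualInfo_le_klDiv`). This is
the chain rule for the Kullback-Leibler divergence, read in the order `W, V, U`. If the output is
`F z n` with independent noise `n`, the right-hand side is an average over the data `z`, so it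
suffices to bound the divergence of the law of `F z n` from `Q (W z)` for each admissible `z`
(`condMutualInfo_noise_le`).

For the encoder, `Q` is the law of the output computed from the dataset whose entry `(j, k)` has
been replaced by zero, a function of the conditioning variable alone, with the noise variance `v`
raised to `1 + v` at the positions of `XᵀX` and `XᵀY` that depend on `X j k`. These are the
positions in row or column `k` of `XᵀX` and in row `k` of `XᵀY`: there are `2 * d - 1` and `o` of
them, and there the entry `X j k` contributes a product of two entries of the dataset, of absolute
value at most `1`. By data processing and tensorization (`klDiv_pi_le`) the divergence splits into
scalar ones, which vanish at the other positions; at these they are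
`klDiv (gaussianReal a v) (gaussianReal 0 (1 + v)) ≤ (1 / 2) * log ((1 + v) / v)`
for `|a| ≤ 1` (`klDiv_gaussianReal_add_one_le`).
-/

namespace InformationTheory

/-! ### Divergence of composition-products -/

section Kernels

variable {α β γ : Type*} [MeasurableSpace α] [MeasurableSpace β] [MeasurableSpace γ]

lemma compProd_eq_withDensity_rnDeriv [MeasurableSpace.CountableOrCountablyGenerated α β]
    {μ : Measure α} [IsFiniteMeasure μ] {κ η : Kernel α β} [IsFiniteKernel κ] [IsFiniteKernel η]
    (h : ∀ᵐ a ∂μ, κ a ≪ η a) :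
    μ ⊗ₘ κ = (μ ⊗ₘ η).withDensity (fun p ↦ κ.rnDeriv η p.1 p.2) := by
  have hm := Kernel.measurable_rnDeriv κ η
  ext s hs
  rw [withDensity_apply _ hs, ← lintegral_indicator hs,
    Measure.lintegral_compProd (hm.indicator hs), Measure.compProd_apply hs]
  refine lintegral_congr_ae ?_
  filter_upwards [h] with a ha
  rw [← Kernel.setLIntegral_rnDeriv ha (measurable_prodMk_left hs),
    ← lintegral_indicator (measurable_prodMk_left hs)]
  rfl

/-- The conditional divergence is the average of the pointwise divergences, because the
kernel Radon-Nikodym derivative is jointly measurable. -/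
lemma klDiv_compProd_eq_lintegral [MeasurableSpace.CountableOrCountablyGenerated α β]
    {μ : Measure α} [IsFiniteMeasure μ] {κ η : Kernel α β} [IsFiniteKernel κ] [IsFiniteKernel η]
    (h : ∀ᵐ a ∂μ, κ a ≪ η a) :
    klDiv (μ ⊗ₘ κ) (μ ⊗ₘ η) = ∫⁻ a, klDiv (κ a) (η a) ∂μ := by
  have hm := Kernel.measurable_rnDeriv κ η
  rw [klDiv_eq_lintegral_klFun_of_ac (Measure.AbsolutelyContinuous.compProd_right h)]
  have hd : (μ ⊗ₘ κ).rnDeriv (μ ⊗ₘ η) =ᵐ[μ ⊗ₘ η] fun p ↦ κ.rnDeriv η p.1 p.2 := by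
    rw [compProd_eq_withDensity_rnDeriv h]
    exact Measure.rnDeriv_withDensity _ hm
  rw [lintegral_congr_ae (hd.mono fun p hp ↦ by rw [hp]),
    Measure.lintegral_compProd (by fun_prop)]
  refine lintegral_congr_ae ?_
  filter_upwards [h] with a ha
  rw [klDiv_eq_lintegral_klFun_of_ac ha]
  refine lintegral_congr_ae ?_
  filter_upwards [Kernel.rnDeriv_eq_rnDeriv_measure (κ := κ) (η := η) (a := a)] with b hb
  rw [hb]

/-- A pointwise bound on the divergence of two kernels bounds the divergence of their
composition-products with a common probability measure. -/
lemma klDiv_compProd_le [MeasurableSpace.CountableOrCountablyGenerated α β]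
    {μ : Measure α} [IsProbabilityMeasure μ] {κ η : Kernel α β} [IsFiniteKernel κ]
    [IsFiniteKernel η] {C : ℝ≥0∞} (h : ∀ᵐ a ∂μ, klDiv (κ a) (η a) ≤ C) :
    klDiv (μ ⊗ₘ κ) (μ ⊗ₘ η) ≤ C := by
  rcases eq_or_ne C ∞ with rfl | hC
  · exact le_top
  have hac : ∀ᵐ a ∂μ, κ a ≪ η a := h.mono fun a ha ↦
    (klDiv_ne_top_iff.mp (ne_top_of_le_ne_top hC ha)).1
  rw [klDiv_compProd_eq_lintegral hac]
  calc ∫⁻ a, klDiv (κ a) (η a) ∂μ ≤ ∫⁻ _, C ∂μ := lintegral_mono_ae h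
    _ = C := by simp

/-- Drawing `U` and then `V`, each from its conditional law given `W`, is drawing them conditionally
independently. -/
lemma map_assoc_compProd_prodMkRight {μ : Measure γ} [SFinite μ] (κ : Kernel γ α)
    (η : Kernel γ β) [IsSFiniteKernel κ] [IsSFiniteKernel η] :
    ((μ ⊗ₘ κ) ⊗ₘ Kernel.prodMkRight α η).map (fun p ↦ (p.1.1, (p.1.2, p.2)))
      = μ ⊗ₘ (κ ×ₖ η) := by
  have hg : Measurable (fun p : (γ × α) × β ↦ (p.1.1, (p.1.2, p.2))) := by fun_prop
  refine Measure.ext_of_lintegral _ fun f hf ↦ ?_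
  rw [lintegral_map hf hg, Measure.lintegral_compProd (by fun_prop),
    Measure.lintegral_compProd (by fun_prop), Measure.lintegral_compProd (by fun_prop)]
  refine lintegral_congr fun w ↦ ?_
  rw [Kernel.prod_apply, lintegral_prod _ (by fun_prop)]
  rfl

lemma map_swap_compProd_prodMkRight {μ : Measure γ} [SFinite μ] (κ : Kernel γ α)
    (η : Kernel γ β) [IsSFiniteKernel κ] [IsSFiniteKernel η] :
    ((μ ⊗ₘ κ) ⊗ₘ Kernel.prodMkRight α η).map (fun p ↦ ((p.1.1, p.2), p.1.2))
      = (μ ⊗ₘ η) ⊗ₘ Kernel.prodMkRight β κ := by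
  have hg : Measurable (fun p : (γ × α) × β ↦ ((p.1.1, p.2), p.1.2)) := by fun_prop
  refine Measure.ext_of_lintegral _ fun f hf ↦ ?_
  have h : Measurable fun x : γ × α ↦
      ∫⁻ b, f ((x.1, b), x.2) ∂(Kernel.prodMkRight α η) x :=
    (hf.comp hg).lintegral_kernel_prod_right'
  have h' : Measurable fun x ↦ ∫⁻ b, f (x, b) ∂(Kernel.prodMkRight β κ) x :=
    hf.lintegral_kernel_prod_right'
  rw [lintegral_map hf hg, Measure.lintegral_compProd (by fun_prop),
    Measure.lintegral_compProd hf, Measure.lintegral_compProd h,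
    Measure.lintegral_compProd h']
  refine lintegral_congr fun w ↦ ?_
  simp only [Kernel.prodMkRight_apply]
  exact lintegral_lintegral_swap (by fun_prop)

/-- The kernel sending `z` to the law of `F z n`, where the noise `n` has law `G`. -/
noncomputable def noiseKernel (G : Measure α) (F : γ → α → β) : Kernel γ β :=
  (Kernel.id ×ₖ Kernel.const γ G).map (Function.uncurry F)

lemma noiseKernel_apply (G : Measure α) [SFinite G] {F : γ → α → β}
    (hF : Measurable (Function.uncurry F)) (z : γ) : noiseKernel G F z = G.map (F z) := by
  rw [noiseKernel, Kernel.map_apply _ hF, Kernel.prod_apply, Kernel.id_apply, Kernel.const_apply,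
    Measure.dirac_prod, Measure.map_map hF (by fun_prop)]
  rfl

lemma isMarkovKernel_noiseKernel (G : Measure α) [IsProbabilityMeasure G] {F : γ → α → β}
    (hF : Measurable (Function.uncurry F)) : IsMarkovKernel (noiseKernel G F) :=
  Kernel.IsMarkovKernel.map _ hF

lemma map_prodMk_noise {Ω : Type*} [MeasurableSpace Ω] {p : Measure γ} {P : Measure Ω}
    [IsProbabilityMeasure p] [IsProbabilityMeasure P] {Z : Ω → α} (hZ : AEMeasurable Z P)
    {F : γ → α → β} (hF : Measurable (Function.uncurry F)) :
    (p.prod P).map (fun t ↦ (t.1, F t.1 (Z t.2))) = p ⊗ₘ noiseKernel (P.map Z) F := by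
  have : IsProbabilityMeasure (P.map Z) := Measure.isProbabilityMeasure_map hZ
  have := isMarkovKernel_noiseKernel (P.map Z) hF
  have hZ' : AEMeasurable (Prod.map id Z) (p.prod P) :=
    measurable_fst.aemeasurable.prodMk hZ.comp_snd
  have hG : Measurable (fun t : γ × α ↦ (t.1, F t.1 t.2)) := measurable_fst.prodMk hF
  have hprod : p.prod (P.map Z) = (p.prod P).map (Prod.map id Z) := by
    refine Measure.prod_eq fun s t hs ht ↦ ?_
    rw [Measure.map_apply_of_aemeasurable hZ' (hs.prod ht),
      Measure.map_apply_of_aemeasurable hZ ht, ← Measure.prod_prod]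
    rfl
  have h : (p.prod P).map (fun t ↦ (t.1, F t.1 (Z t.2)))
      = (p.prod (P.map Z)).map (fun t ↦ (t.1, F t.1 t.2)) := by
    rw [hprod, AEMeasurable.map_map_of_aemeasurable hG.aemeasurable hZ']
    rfl
  refine Measure.ext_of_lintegral _ fun f hf ↦ ?_
  rw [Measure.lintegral_compProd hf, h, lintegral_map hf hG, lintegral_prod _ (by fun_prop)]
  refine lintegral_congr fun z ↦ ?_
  have hFz : Measurable (F z) := hF.comp measurable_prodMk_left
  rw [noiseKernel_apply _ hF, lintegral_map (by fun_prop) hFz]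

end Kernels

/-! ### Upper bounds on conditional mutual information -/

section CondMutualInfo

variable {Ω α β γ : Type*} [MeasurableSpace Ω]
  [MeasurableSpace α] [StandardBorelSpace α] [Nonempty α]
  [MeasurableSpace β] [StandardBorelSpace β] [Nonempty β] [MeasurableSpace γ]

/-- Replacing the conditional law of `V` given `W` by any other kernel `Q` can only increase the
divergence from the joint law: the excess is the divergence of the law of `(W, V)` from
`P_W ⊗ Q`, which the chain rule splits off. -/
lemma condMutualInfo_le_klDiv {μ : Measure Ω} [IsFiniteMeasure μ] {U : Ω → α} {V : Ω → β}
    {W : Ω → γ} (hU : AEMeasurable U μ) (hV : AEMeasurable V μ) (hW : AEMeasurable W μ)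
    (Q : Kernel γ β) [IsMarkovKernel Q] :
    condMutualInfo U V W μ ≤
      klDiv (μ.map fun ω ↦ ((W ω, U ω), V ω))
        ((μ.map fun ω ↦ (W ω, U ω)) ⊗ₘ Kernel.prodMkRight α Q) := by
  set κU := condDistrib U W μ
  set κV := condDistrib V W μ
  set κ := condDistrib U (fun ω ↦ (W ω, V ω)) μ
  have hWV : (μ.map fun ω ↦ (W ω, V ω)) = μ.map W ⊗ₘ κV := (compProd_map_condDistrib hV).symm
  have hWU : (μ.map fun ω ↦ (W ω, U ω)) = μ.map W ⊗ₘ κU := (compProd_map_condDistrib hU).symm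
  have hWVU : (μ.map fun ω ↦ ((W ω, V ω), U ω)) = (μ.map fun ω ↦ (W ω, V ω)) ⊗ₘ κ :=
    (compProd_map_condDistrib hU).symm
  calc condMutualInfo U V W μ
    _ = klDiv (((μ.map fun ω ↦ (W ω, V ω)) ⊗ₘ κ).map fun p ↦ (p.1.1, (p.2, p.1.2)))
          (((μ.map fun ω ↦ (W ω, V ω)) ⊗ₘ Kernel.prodMkRight β κU).map
            fun p ↦ (p.1.1, (p.2, p.1.2))) := by
      unfold condMutualInfo
      rw [← hWVU, hWV, ← map_swap_compProd_prodMkRight,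
        AEMeasurable.map_map_of_aemeasurable (by fun_prop) ((hW.prodMk hV).prodMk hU),
        Measure.map_map (by fun_prop) (by fun_prop), ← map_assoc_compProd_prodMkRight]
      rfl
    _ ≤ klDiv ((μ.map fun ω ↦ (W ω, V ω)) ⊗ₘ κ)
          ((μ.map fun ω ↦ (W ω, V ω)) ⊗ₘ Kernel.prodMkRight β κU) :=
      klDiv_map_le _ _ (by fun_prop)
    -- the second term of the chain rule in the order `W, V, U`; the first one is dropped
    _ ≤ klDiv ((μ.map fun ω ↦ (W ω, V ω)) ⊗ₘ κ)
          ((μ.map W ⊗ₘ Q) ⊗ₘ Kernel.prodMkRight β κU) := by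
      rw [klDiv_compProd_eq_add _ (μ.map W ⊗ₘ Q)]
      exact le_add_self
    _ = klDiv ((μ.map fun ω ↦ ((W ω, U ω), V ω)).map fun p ↦ ((p.1.1, p.2), p.1.2))
          (((μ.map fun ω ↦ (W ω, U ω)) ⊗ₘ Kernel.prodMkRight α Q).map
            fun p ↦ ((p.1.1, p.2), p.1.2)) := by
      rw [← hWVU, hWU, map_swap_compProd_prodMkRight,
        AEMeasurable.map_map_of_aemeasurable (by fun_prop) ((hW.prodMk hU).prodMk hV)]
      rfl
    _ ≤ _ := klDiv_map_le _ _ (by fun_prop)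

/-- Conditional mutual information across a noisy channel `z ↦ F z (Z ω)`, with `Z` independent of
the data `z`, is bounded by the worst divergence of the output law from a kernel `Q` that only sees
`W z`. -/
lemma condMutualInfo_noise_le {D M : Type*} [MeasurableSpace D] [MeasurableSpace M]
    {p : Measure D} [IsProbabilityMeasure p] {P : Measure Ω} [IsProbabilityMeasure P]
    {U : D → α} {W : D → γ} (hU : Measurable U) (hW : Measurable W)
    {Z : Ω → M} (hZ : AEMeasurable Z P) {F : D → M → β} (hF : Measurable (Function.uncurry F))
    (Q : Kernel γ β) [IsMarkovKernel Q] {C : ℝ≥0∞}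
    (h : ∀ᵐ z ∂p, klDiv ((P.map Z).map (F z)) (Q (W z)) ≤ C) :
    condMutualInfo (fun t : D × Ω ↦ U t.1) (fun t ↦ F t.1 (Z t.2)) (fun t ↦ W t.1) (p.prod P)
      ≤ C := by
  have : IsProbabilityMeasure (P.map Z) := Measure.isProbabilityMeasure_map hZ
  have hV : AEMeasurable (fun t : D × Ω ↦ F t.1 (Z t.2)) (p.prod P) :=
    hF.comp_aemeasurable (measurable_fst.aemeasurable.prodMk hZ.comp_snd)
  set κ := noiseKernel (P.map Z) F with hκ
  have : IsMarkovKernel κ := isMarkovKernel_noiseKernel _ hF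
  refine (condMutualInfo_le_klDiv (hU.comp measurable_fst).aemeasurable hV
    (hW.comp measurable_fst).aemeasurable Q).trans ?_
  have hmap : Measurable (fun t : D × β ↦ ((W t.1, U t.1), t.2)) := by fun_prop
  calc _ = klDiv ((p ⊗ₘ κ).map fun t ↦ ((W t.1, U t.1), t.2))
        ((p ⊗ₘ Q.comap W hW).map fun t ↦ ((W t.1, U t.1), t.2)) := by
        congr 1
        · rw [← map_prodMk_noise hZ hF, AEMeasurable.map_map_of_aemeasurable (by fun_prop)
            (measurable_fst.aemeasurable.prodMk hV)]
          rfl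
        · have h2 : (p.prod P).map (fun t : D × Ω ↦ ((W ∘ Prod.fst) t, (U ∘ Prod.fst) t))
              = p.map (fun z ↦ (W z, U z)) := by
            have : (fun t : D × Ω ↦ ((W ∘ Prod.fst) t, (U ∘ Prod.fst) t))
                = (fun z ↦ (W z, U z)) ∘ Prod.fst := rfl
            rw [this, ← Measure.map_map (by fun_prop) (by fun_prop)]
            simp
          refine Measure.ext_of_lintegral _ fun f hf ↦ ?_
          have h' : Measurable fun x ↦ ∫⁻ b, f (x, b) ∂(Kernel.prodMkRight α Q) x :=
            hf.lintegral_kernel_prod_right'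
          rw [h2, Measure.lintegral_compProd hf, lintegral_map hf hmap,
            Measure.lintegral_compProd (by fun_prop), lintegral_map h' (by fun_prop)]
          rfl
    _ ≤ klDiv (p ⊗ₘ κ) (p ⊗ₘ Q.comap W hW) := klDiv_map_le _ _ hmap
    _ ≤ C := klDiv_compProd_le (h.mono fun z hz ↦ by
      rwa [hκ, noiseKernel_apply _ hF, Kernel.comap_apply])

end CondMutualInfo

/-! ### Tensorization of the divergence -/

section Products

lemma klDiv_prod_left {α β : Type*} [MeasurableSpace α] [MeasurableSpace β]
    (μ : Measure α) (μ' ν' : Measure β) [IsProbabilityMeasure μ] [IsProbabilityMeasure μ']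
    [IsProbabilityMeasure ν'] : klDiv (μ.prod μ') (μ.prod ν') = klDiv μ' ν' := by
  refine le_antisymm ?_ ?_
  · rw [← klDiv_compProd_left μ' ν' (Kernel.const β μ), Measure.compProd_const,
      Measure.compProd_const, ← Measure.prod_swap (μ := μ') (ν := μ),
      ← Measure.prod_swap (μ := ν') (ν := μ)]
    exact klDiv_map_le _ _ measurable_swap
  · simpa using klDiv_map_le (μ.prod μ') (μ.prod ν') measurable_snd

lemma klDiv_prod {α β : Type*} [MeasurableSpace α] [MeasurableSpace β]
    (μ ν : Measure α) (μ' ν' : Measure β) [IsProbabilityMeasure μ] [IsProbabilityMeasure ν]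
    [IsProbabilityMeasure μ'] [IsProbabilityMeasure ν'] :
    klDiv (μ.prod μ') (ν.prod ν') = klDiv μ ν + klDiv μ' ν' := by
  simpa only [Measure.compProd_const, klDiv_prod_left] using
    klDiv_compProd_eq_add μ ν (Kernel.const α μ') (Kernel.const α ν')

lemma klDiv_pi_fin_le {X : Type*} [MeasurableSpace X] {n : ℕ} (μ ν : Fin n → Measure X)
    [∀ i, IsProbabilityMeasure (μ i)] [∀ i, IsProbabilityMeasure (ν i)] :
    klDiv (Measure.pi μ) (Measure.pi ν) ≤ ∑ i, klDiv (μ i) (ν i) := by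
  induction n with
  | zero =>
    rw [Measure.pi_of_empty μ, Measure.pi_of_empty ν]
    simp
  | succ n ih =>
    rw [Fin.sum_univ_succ, ← ((measurePreserving_piFinSuccAbove μ 0).symm _).map_eq,
      ← ((measurePreserving_piFinSuccAbove ν 0).symm _).map_eq]
    refine (klDiv_map_le _ _ (MeasurableEquiv.measurable _)).trans ?_
    rw [klDiv_prod]
    gcongr
    exact ih _ _

/-- Only the inequality is needed, so data processing along the reindexing suffices; equality holds
as well. -/
lemma klDiv_pi_le {ι X : Type*} [Fintype ι] [MeasurableSpace X] (μ ν : ι → Measure X)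
    [∀ i, IsProbabilityMeasure (μ i)] [∀ i, IsProbabilityMeasure (ν i)] :
    klDiv (Measure.pi μ) (Measure.pi ν) ≤ ∑ i, klDiv (μ i) (ν i) := by
  let e := (Fintype.equivFin ι).symm
  rw [← (measurePreserving_piCongrLeft μ e).map_eq, ← (measurePreserving_piCongrLeft ν e).map_eq,
    ← e.sum_comp]
  exact (klDiv_map_le _ _ (MeasurableEquiv.measurable _)).trans (klDiv_pi_fin_le _ _)

end Products

/-! ### Divergence of real Gaussians -/

section Gaussian

lemma llr_gaussianReal (a b : ℝ) {v w : ℝ≥0} (hv : v ≠ 0) (hw : w ≠ 0) :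
    llr (gaussianReal a v) (gaussianReal b w) =ᵐ[gaussianReal a v] fun x ↦
      (1 / 2) * Real.log (w / v) + ((x - b) ^ 2 / (2 * w) - (x - a) ^ 2 / (2 * v)) := by
  have hac := gaussianReal_absolutelyContinuous a hv
  have h1 := Measure.rnDeriv_eq_div hac (gaussianReal_absolutelyContinuous b hw)
  filter_upwards [hac.ae_le (rnDeriv_gaussianReal a v), hac.ae_le (rnDeriv_gaussianReal b w),
    (hac.trans (gaussianReal_absolutelyContinuous' b hw)).ae_le h1] with x ha hb hx
  have hv' : (0 : ℝ) < v := by positivity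
  have hw' : (0 : ℝ) < w := by positivity
  have hlog (u : ℝ) (hu : 0 < u) :
      Real.log (2 * Real.pi * u) = Real.log (2 * Real.pi) + Real.log u :=
    Real.log_mul (by positivity) hu.ne'
  rw [llr, hx, ha, hb, ENNReal.toReal_div, toReal_gaussianPDF, toReal_gaussianPDF]
  simp only [gaussianPDFReal]
  rw [Real.log_div (by positivity) (by positivity), Real.log_mul (by positivity) (by positivity),
    Real.log_mul (by positivity) (by positivity), Real.log_exp, Real.log_exp, Real.log_inv,
    Real.log_inv, Real.log_sqrt (by positivity), Real.log_sqrt (by positivity),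
    hlog _ hv', hlog _ hw', Real.log_div hw'.ne' hv'.ne']
  ring

lemma integrable_sub_sq_gaussianReal (a b : ℝ) (v : ℝ≥0) :
    Integrable (fun x ↦ (x - b) ^ 2) (gaussianReal a v) :=
  ((memLp_id_gaussianReal' 2 (by simp)).sub (memLp_const b)).integrable_sq

lemma integral_sub_sq_gaussianReal (a b : ℝ) (v : ℝ≥0) :
    ∫ x, (x - b) ^ 2 ∂gaussianReal a v = v + (a - b) ^ 2 := by
  have hX : Integrable (fun x : ℝ ↦ x) (gaussianReal a v) :=
    (memLp_id_gaussianReal' 1 (by simp)).integrable le_rfl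
  have hvar : ∫ x, (x - a) ^ 2 ∂gaussianReal a v = v := by
    rw [← variance_fun_id_gaussianReal (μ := a) (v := v), variance_eq_integral (by fun_prop),
      integral_id_gaussianReal]
  have h : ∀ x : ℝ, (x - b) ^ 2 = (x - a) ^ 2 + (2 * (a - b) * x + (b ^ 2 - a ^ 2)) := by
    intro x; ring
  have hl : Integrable (fun x : ℝ ↦ 2 * (a - b) * x + (b ^ 2 - a ^ 2)) (gaussianReal a v) :=
    (hX.const_mul _).add (integrable_const _)
  simp_rw [h]
  rw [integral_add (integrable_sub_sq_gaussianReal a a v) hl, hvar, integral_add (hX.const_mul _)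
    (integrable_const _), integral_const_mul, integral_id_gaussianReal]
  simp

lemma klDiv_gaussianReal (a b : ℝ) {v w : ℝ≥0} (hv : v ≠ 0) (hw : w ≠ 0) :
    klDiv (gaussianReal a v) (gaussianReal b w) = ENNReal.ofReal
      ((1 / 2) * Real.log (w / v) + ((v + (a - b) ^ 2) / (2 * w) - 1 / 2)) := by
  have hv' : (v : ℝ) ≠ 0 := by exact_mod_cast hv
  have hllr := llr_gaussianReal a b hv hw
  have i1 := (integrable_sub_sq_gaussianReal a b v).div_const (2 * w : ℝ)
  have i2 := (integrable_sub_sq_gaussianReal a a v).div_const (2 * v : ℝ)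
  have i12 : Integrable (fun x ↦ (x - b) ^ 2 / (2 * w : ℝ) - (x - a) ^ 2 / (2 * v : ℝ))
      (gaussianReal a v) := i1.sub i2
  have hint : Integrable (llr (gaussianReal a v) (gaussianReal b w)) (gaussianReal a v) :=
    ((integrable_const _).add i12).congr hllr.symm
  rw [klDiv_of_ac_of_integrable ((gaussianReal_absolutelyContinuous a hv).trans
    (gaussianReal_absolutelyContinuous' b hw)) hint, integral_congr_ae hllr,
    integral_add (integrable_const _) i12, integral_sub i1 i2, integral_div, integral_div,
    integral_sub_sq_gaussianReal, integral_sub_sq_gaussianReal]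
  congr 1
  simp
  field_simp

/-- The reference variance `1 + v` makes the quadratic term `(v + (a - b) ^ 2) / (2 * (1 + v))` at
most `1 / 2`, which cancels the constant of the Gaussian divergence. -/
lemma klDiv_gaussianReal_add_one_le {a b : ℝ} (hab : |a - b| ≤ 1) {v : ℝ≥0} (hv : v ≠ 0) :
    klDiv (gaussianReal a v) (gaussianReal b (1 + v)) ≤
      ENNReal.ofReal ((1 / 2) * Real.log ((1 + v) / v)) := by
  rw [klDiv_gaussianReal a b hv (by positivity)]
  refine ENNReal.ofReal_le_ofReal ?_
  have h1 : (a - b) ^ 2 ≤ 1 := by rwa [sq_le_one_iff_abs_le_one]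
  have h2 : (v + (a - b) ^ 2) / (2 * (1 + v)) ≤ (1 / 2 : ℝ) := by
    rw [div_le_iff₀ (by positivity)]
    linarith
  push_cast
  linarith

end Gaussian

end InformationTheory

open InformationTheory

/-! ### The part of the Gram matrices that depends on one entry -/

section Matrices

lemma Matrix.measurable_of_entries {α a b : Type*} [MeasurableSpace α] {f : α → Matrix a b ℝ}
    (h : ∀ i j, Measurable fun x ↦ f x i j) : Measurable f :=
  measurable_pi_lambda _ fun i ↦ measurable_pi_lambda _ fun j ↦ h i j

lemma Matrix.measurable_entry {a b : Type*} (i : a) (j : b) :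
    Measurable fun A : Matrix a b ℝ ↦ A i j :=
  (measurable_pi_apply j).comp (measurable_pi_apply (X := fun _ : a ↦ b → ℝ) i)

/-- The matrix with a zero at `(j, k)` and with the prescribed other entries. -/
def zeroFill {m n : ℕ} (j : Fin m) (k : Fin n) (w : {e : Fin m × Fin n // e ≠ (j, k)} → ℝ) :
    Matrix (Fin m) (Fin n) ℝ :=
  Matrix.of fun a b ↦ if h : (a, b) ≠ (j, k) then w ⟨(a, b), h⟩ else 0

lemma zeroFill_otherEntries {m n : ℕ} (X : Matrix (Fin m) (Fin n) ℝ) (j a : Fin m)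
    (k b : Fin n) :
    zeroFill j k (otherEntries X j k) a b = if a = j ∧ b = k then 0 else X a b := by
  by_cases h : a = j ∧ b = k <;> simp [zeroFill, otherEntries, h]

/-- The entry `X j k` enters `XᵀX` only in row and column `k`, where its contribution is
`X j a * X j b`; at `a = b = k` this is `X j k ^ 2`. -/
lemma transpose_mul_self_eq_zeroFill_add {m d : ℕ} (X : Matrix (Fin m) (Fin d) ℝ) (j : Fin m)
    (k a b : Fin d) :
    (Xᵀ * X) a b =
      ((zeroFill j k (otherEntries X j k))ᵀ * zeroFill j k (otherEntries X j k)) a b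
        + if a = k ∨ b = k then X j a * X j b else 0 := by
  rw [← sub_eq_iff_eq_add']
  simp only [Matrix.mul_apply, Matrix.transpose_apply, ← Finset.sum_sub_distrib,
    zeroFill_otherEntries]
  rw [Finset.sum_eq_single j]
  · by_cases ha : a = k <;> by_cases hb : b = k <;> simp [ha, hb]
  · intro r _ hr
    simp [hr]
  · simp

lemma transpose_mul_eq_zeroFill_add {m d o : ℕ} (X : Matrix (Fin m) (Fin d) ℝ)
    (Y : Matrix (Fin m) (Fin o) ℝ) (j : Fin m) (k a : Fin d) (b : Fin o) :
    (Xᵀ * Y) a b = ((zeroFill j k (otherEntries X j k))ᵀ * Y) a b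
      + if a = k then X j a * Y j b else 0 := by
  rw [← sub_eq_iff_eq_add']
  simp only [Matrix.mul_apply, Matrix.transpose_apply, ← Finset.sum_sub_distrib,
    zeroFill_otherEntries]
  rw [Finset.sum_eq_single j]
  · by_cases ha : a = k <;> simp [ha]
  · intro r _ hr
    simp [hr]
  · simp

lemma measurable_otherEntries {m n : ℕ} (j : Fin m) (k : Fin n) :
    Measurable fun X : Matrix (Fin m) (Fin n) ℝ ↦ otherEntries X j k :=
  measurable_pi_lambda _ fun e ↦ Matrix.measurable_entry e.1.1 e.1.2

lemma measurable_zeroFill {m n : ℕ} (j : Fin m) (k : Fin n) : Measurable (zeroFill j k) := by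
  refine Matrix.measurable_of_entries fun a b ↦ ?_
  by_cases h : (a, b) ≠ (j, k)
  · simpa only [zeroFill, Matrix.of_apply, dif_pos h] using measurable_pi_apply _
  · simpa only [zeroFill, Matrix.of_apply, dif_neg h] using measurable_const

/-- The encoder as a function of the data and of the noise, the two noise matrices being given as
families indexed by the positions of their entries. -/
def noisyGram {m d o : ℕ} (z : Matrix (Fin m) (Fin d) ℝ × Matrix (Fin m) (Fin o) ℝ)
    (n : (Fin d × Fin d → ℝ) × (Fin d × Fin o → ℝ)) :
    Matrix (Fin d) (Fin d) ℝ × Matrix (Fin d) (Fin o) ℝ :=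
  (z.1ᵀ * z.1 + Matrix.of fun a b ↦ n.1 (a, b), z.1ᵀ * z.2 + Matrix.of fun a b ↦ n.2 (a, b))

lemma measurable_noisyGram {m d o : ℕ} :
    Measurable (Function.uncurry (noisyGram (m := m) (d := d) (o := o))) := by
  have hX (r : Fin m) (a : Fin d) : Measurable
      fun t : (Matrix (Fin m) (Fin d) ℝ × Matrix (Fin m) (Fin o) ℝ) ×
        (Fin d × Fin d → ℝ) × (Fin d × Fin o → ℝ) ↦ t.1.1 r a :=
    (Matrix.measurable_entry r a).comp (measurable_fst.comp measurable_fst)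
  have hY (r : Fin m) (a : Fin o) : Measurable
      fun t : (Matrix (Fin m) (Fin d) ℝ × Matrix (Fin m) (Fin o) ℝ) ×
        (Fin d × Fin d → ℝ) × (Fin d × Fin o → ℝ) ↦ t.1.2 r a :=
    (Matrix.measurable_entry r a).comp (measurable_snd.comp measurable_fst)
  refine Measurable.prodMk (Matrix.measurable_of_entries fun a b ↦ ?_)
    (Matrix.measurable_of_entries fun a b ↦ ?_)
  · simp only [Matrix.add_apply, Matrix.mul_apply, Matrix.transpose_apply, Matrix.of_apply]
    exact (Finset.measurable_sum _ fun r _ ↦ (hX r a).mul (hX r b)).add (by fun_prop)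
  · simp only [Matrix.add_apply, Matrix.mul_apply, Matrix.transpose_apply, Matrix.of_apply]
    exact (Finset.measurable_sum _ fun r _ ↦ (hX r a).mul (hY r b)).add (by fun_prop)

lemma measurable_zeroFill_fst {m d o : ℕ} (j : Fin m) (k : Fin d) :
    Measurable fun w : ({e : Fin m × Fin d // e ≠ (j, k)} → ℝ) × Matrix (Fin m) (Fin o) ℝ ↦
      (zeroFill j k w.1, w.2) :=
  ((measurable_zeroFill j k).comp measurable_fst).prodMk measurable_snd

lemma measurable_noisyGram_zeroFill {m d o : ℕ} (j : Fin m) (k : Fin d) :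
    Measurable (Function.uncurry
      fun w : ({e : Fin m × Fin d // e ≠ (j, k)} → ℝ) × Matrix (Fin m) (Fin o) ℝ ↦
        noisyGram (zeroFill j k w.1, w.2)) := by
  have h := measurable_noisyGram.comp ((measurable_zeroFill_fst (o := o) j k).prodMap
    (measurable_id (α := (Fin d × Fin d → ℝ) × (Fin d × Fin o → ℝ))))
  exact h

/-- The dependence of the output on the entry `(j, k)` is a shift of the noise. -/
lemma noisyGram_eq_zeroFill {m d o : ℕ}
    (z : Matrix (Fin m) (Fin d) ℝ × Matrix (Fin m) (Fin o) ℝ) (j : Fin m) (k : Fin d)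
    (n : (Fin d × Fin d → ℝ) × (Fin d × Fin o → ℝ)) :
    noisyGram z n = noisyGram (zeroFill j k (otherEntries z.1 j k), z.2)
      (fun e ↦ (if e.1 = k ∨ e.2 = k then z.1 j e.1 * z.1 j e.2 else 0) + n.1 e,
        fun e ↦ (if e.1 = k then z.1 j e.1 * z.2 j e.2 else 0) + n.2 e) := by
  refine Prod.ext ?_ ?_ <;> ext a b
  · simp only [noisyGram, Matrix.add_apply, Matrix.of_apply, ← add_assoc]
    rw [transpose_mul_self_eq_zeroFill_add z.1 j k a b]
  · simp only [noisyGram, Matrix.add_apply, Matrix.of_apply, ← add_assoc]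
    rw [transpose_mul_eq_zeroFill_add z.1 z.2 j k a b]

end Matrices

/-! ### Families of independent Gaussians -/

section Noise

/-- The law of a family of independent Gaussian variables with means `c` and variances `v`. -/
noncomputable abbrev gaussianFamily {ι : Type*} [Fintype ι] (c : ι → ℝ) (v : ι → ℝ≥0) :
    Measure (ι → ℝ) :=
  Measure.pi fun e ↦ gaussianReal (c e) (v e)

lemma map_const_add_gaussianFamily {ι : Type*} [Fintype ι] (c : ι → ℝ) (v : ι → ℝ≥0) :
    (gaussianFamily 0 v).map (fun n e ↦ c e + n e) = gaussianFamily c v := by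
  have (e : ι) : (gaussianReal 0 (v e)).map (fun x ↦ c e + x) = gaussianReal (c e) (v e) := by
    rw [gaussianReal_map_const_add, zero_add]
  have h := Measure.pi_map_pi (μ := fun e ↦ gaussianReal 0 (v e)) (f := fun e x ↦ c e + x)
    (hμ := fun e ↦ by rw [this]; infer_instance) (fun e ↦ by fun_prop)
  simp only [this] at h
  exact h

/-- On the set `s` of affected positions the means are bounded by `1` and the reference variance is
raised by `1`; elsewhere the two laws agree and contribute nothing. -/
lemma klDiv_gaussianFamily_le {ι : Type*} [Fintype ι] {c : ι → ℝ} (s : ι → Prop)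
    [DecidablePred s] (hs : ∀ e, s e → |c e| ≤ 1) (hs' : ∀ e, ¬ s e → c e = 0) {v : ℝ≥0}
    (hv : v ≠ 0) :
    klDiv (gaussianFamily c fun _ ↦ v) (gaussianFamily 0 fun e ↦ if s e then 1 + v else v)
      ≤ ENNReal.ofReal (∑ e, if s e then (1 / 2) * Real.log ((1 + v) / v) else 0) := by
  have hv' : (0 : ℝ) < v := by positivity
  have hlog : 0 ≤ Real.log ((1 + v) / v) :=
    Real.log_nonneg (by rw [le_div_iff₀ hv']; linarith)
  rw [ENNReal.ofReal_sum_of_nonneg (fun e _ ↦ by split_ifs <;> positivity)]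
  refine (klDiv_pi_le _ _).trans (Finset.sum_le_sum fun e _ ↦ ?_)
  by_cases h : s e
  · simpa only [h, if_true] using klDiv_gaussianReal_add_one_le (by simpa using hs e h) hv
  · simp [h, hs' e h]

variable {Ω : Type*} [MeasurableSpace Ω] {P : Measure Ω}

lemma IsGaussianNoise.aemeasurable_entries {a b : ℕ} {N : Ω → Matrix (Fin a) (Fin b) ℝ} {v : ℝ≥0}
    (h : IsGaussianNoise N v P) : AEMeasurable (fun ω (e : Fin a × Fin b) ↦ N ω e.1 e.2) P :=
  aemeasurable_pi_lambda _ fun e ↦ (h.hasLaw e.1 e.2).aemeasurable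

lemma IsGaussianNoise.map_entries {a b : ℕ} {N : Ω → Matrix (Fin a) (Fin b) ℝ} {v : ℝ≥0}
    (h : IsGaussianNoise N v P) :
    P.map (fun ω (e : Fin a × Fin b) ↦ N ω e.1 e.2) = gaussianFamily 0 fun _ ↦ v := by
  refine (h.indep.map_fun_eq_pi_map
    fun e : Fin a × Fin b ↦ (h.hasLaw e.1 e.2).aemeasurable).trans ?_
  congr 1
  ext1 e
  exact (h.hasLaw e.1 e.2).map_eq

lemma map_noise_eq_prod [IsProbabilityMeasure P] {d o : ℕ}
    {N₁ : Ω → Matrix (Fin d) (Fin d) ℝ} {N₂ : Ω → Matrix (Fin d) (Fin o) ℝ} {v₁ v₂ : ℝ≥0}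
    (h₁ : IsGaussianNoise N₁ v₁ P) (h₂ : IsGaussianNoise N₂ v₂ P) (h : IndepFun N₁ N₂ P) :
    P.map (fun ω ↦ ((fun e : Fin d × Fin d ↦ N₁ ω e.1 e.2),
        (fun e : Fin d × Fin o ↦ N₂ ω e.1 e.2)))
      = (gaussianFamily 0 fun _ ↦ v₁).prod (gaussianFamily 0 fun _ ↦ v₂) := by
  have hm (b : ℕ) : Measurable fun (A : Matrix (Fin d) (Fin b) ℝ) (e : Fin d × Fin b) ↦
      A e.1 e.2 := measurable_pi_lambda _ fun e ↦ Matrix.measurable_entry e.1 e.2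
  rw [← h₁.map_entries, ← h₂.map_entries]
  exact (h.comp (hm d) (hm o)).map_prod_eq_prod_map_map h₁.aemeasurable_entries
    h₂.aemeasurable_entries

end Noise

/-! ### The privacy bound -/

section Bound

lemma sum_row {d o : ℕ} (k : Fin d) (c : ℝ) :
    ∑ e : Fin d × Fin o, (if e.1 = k then c else 0) = o * c := by
  have (a : Fin d) : ∑ _b : Fin o, (if a = k then c else 0) = if a = k then o * c else 0 := by
    split_ifs <;> simp
  simp [Fintype.sum_prod_type, this]

lemma sum_row_or_column {d : ℕ} (k : Fin d) (c : ℝ) :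
    ∑ e : Fin d × Fin d, (if e.1 = k ∨ e.2 = k then c else 0) = (2 * d - 1) * c := by
  have h (e : Fin d × Fin d) : (if e.1 = k ∨ e.2 = k then c else 0)
      = (if e.1 = k then c else 0) + (if e.2 = k then c else 0)
        - (if e.1 = k then if e.2 = k then c else 0 else 0) := by
    by_cases h1 : e.1 = k <;> by_cases h2 : e.2 = k <;> simp [h1, h2]
  simp only [h, Finset.sum_sub_distrib, Finset.sum_add_distrib, sum_row]
  simp [Fintype.sum_prod_type]
  ring

/-- For each admissible dataset, a bound on the divergence of the law of the output from a reference
law. The reference law depends on the dataset only through what the adversary knows: the entries of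
`X` other than `X j k`, and `Y`. -/
lemma klDiv_noisyGram_le {m d o : ℕ} {z : Matrix (Fin m) (Fin d) ℝ × Matrix (Fin m) (Fin o) ℝ}
    (hz : z ∈ boundedData m d o) (j : Fin m) (k : Fin d) {v₁ v₂ : ℝ≥0} (hv₁ : v₁ ≠ 0)
    (hv₂ : v₂ ≠ 0) :
    klDiv
        (((gaussianFamily 0 fun _ ↦ v₁).prod (gaussianFamily 0 fun _ ↦ v₂)).map (noisyGram z))
        (((gaussianFamily 0 fun e ↦ if e.1 = k ∨ e.2 = k then 1 + v₁ else v₁).prod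
          (gaussianFamily 0 fun e ↦ if e.1 = k then 1 + v₂ else v₂)).map
            (noisyGram (zeroFill j k (otherEntries z.1 j k), z.2)))
      ≤ ENNReal.ofReal (((d : ℝ) - 1 / 2) * Real.log ((1 + v₁) / v₁)
          + (o : ℝ) / 2 * Real.log ((1 + v₂) / v₂)) := by
  have hmul {x y : ℝ} (hx : |x| ≤ 1) (hy : |y| ≤ 1) : |x * y| ≤ 1 := by
    rw [abs_mul]
    exact mul_le_one₀ hx (abs_nonneg _) hy
  -- the existence of the column `k` makes the factor `2 * d - 1` nonnegative
  have hd : (1 : ℝ) ≤ d := by exact_mod_cast k.pos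
  have hlog {v : ℝ≥0} (hv : v ≠ 0) : 0 ≤ Real.log ((1 + v) / v) :=
    Real.log_nonneg (by rw [le_div_iff₀ (by positivity)]; linarith)
  set c₁ : Fin d × Fin d → ℝ := fun e ↦ if e.1 = k ∨ e.2 = k then z.1 j e.1 * z.1 j e.2 else 0
    with hc₁
  set c₂ : Fin d × Fin o → ℝ := fun e ↦ if e.1 = k then z.1 j e.1 * z.2 j e.2 else 0 with hc₂
  have hF := (measurable_noisyGram (m := m) (d := d) (o := o)).of_uncurry_left
    (x := (zeroFill j k (otherEntries z.1 j k), z.2))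
  have hshift : noisyGram z = noisyGram (zeroFill j k (otherEntries z.1 j k), z.2) ∘
      Prod.map (fun n e ↦ c₁ e + n e) (fun n e ↦ c₂ e + n e) :=
    funext fun n ↦ noisyGram_eq_zeroFill z j k n
  rw [hshift, ← Measure.map_map hF (by fun_prop), ← Measure.map_prod_map _ _ (by fun_prop)
    (by fun_prop), map_const_add_gaussianFamily, map_const_add_gaussianFamily]
  refine (klDiv_map_le _ _ hF).trans ?_
  rw [klDiv_prod]
  have h₁ := klDiv_gaussianFamily_le (c := c₁) (fun e ↦ e.1 = k ∨ e.2 = k)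
    (fun e he ↦ by simpa only [hc₁, if_pos he] using hmul (hz.1 _ _) (hz.1 _ _))
    (fun e he ↦ by simp only [hc₁, if_neg he]) hv₁
  have h₂ := klDiv_gaussianFamily_le (c := c₂) (fun e ↦ e.1 = k)
    (fun e he ↦ by simpa only [hc₂, if_pos he] using hmul (hz.1 _ _) (hz.2 _ _))
    (fun e he ↦ by simp only [hc₂, if_neg he]) hv₂
  rw [sum_row_or_column] at h₁
  rw [sum_row] at h₂
  refine (add_le_add h₁ h₂).trans ?_
  have := hlog hv₁
  have := hlog hv₂
  rw [← ENNReal.ofReal_add (mul_nonneg (by linarith) (by positivity)) (by positivity)]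
  exact ENNReal.ofReal_le_ofReal (by linarith)

end Bound

theorem theorem1 {Ω : Type*} [MeasurableSpace Ω] (P : Measure Ω) [IsProbabilityMeasure P]
    (N d o : ℕ) (m : Fin N → ℕ) (σ₁ σ₂ : ℝ≥0) (hσ₁ : 0 < σ₁) (hσ₂ : 0 < σ₂)
    (N₁ : Fin N → Ω → Matrix (Fin d) (Fin d) ℝ)
    (N₂ : Fin N → Ω → Matrix (Fin d) (Fin o) ℝ)
    (hN₁ : ∀ i, IsGaussianNoise (N₁ i) (σ₁ ^ 2) P)
    (hN₂ : ∀ i, IsGaussianNoise (N₂ i) (σ₂ ^ 2) P)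
    (hN : ∀ i, IndepFun (N₁ i) (N₂ i) P)
    (i : Fin N) :
    IsMIDP P (boundedData (m i) d o) (acflEncode (N₁ i) (N₂ i))
      (((d : ℝ) - 1 / 2) * Real.log ((1 + (σ₁ : ℝ) ^ 2) / (σ₁ : ℝ) ^ 2)
        + (o : ℝ) / 2 * Real.log ((1 + (σ₂ : ℝ) ^ 2) / (σ₂ : ℝ) ^ 2)) := by
  refine iSup_le fun p ↦ iSup_le fun hp ↦ iSup_le fun j ↦ iSup_le fun k ↦ ?_
  -- reference noise: variance raised by `1` exactly where `X j k` enters the output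
  set G' := (gaussianFamily 0 fun e : Fin d × Fin d ↦
      if e.1 = k ∨ e.2 = k then 1 + σ₁ ^ 2 else σ₁ ^ 2).prod
    (gaussianFamily 0 fun e : Fin d × Fin o ↦ if e.1 = k then 1 + σ₂ ^ 2 else σ₂ ^ 2)
  have hF' := measurable_noisyGram_zeroFill (o := o) j k
  have := isMarkovKernel_noiseKernel G' hF'
  refine condMutualInfo_noise_le (U := fun z ↦ z.1 j k)
    (W := fun z ↦ (otherEntries z.1 j k, z.2)) (F := noisyGram)
    ((Matrix.measurable_entry j k).comp measurable_fst)
    (((measurable_otherEntries j k).comp measurable_fst).prodMk measurable_snd)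
    ((hN₁ i).aemeasurable_entries.prodMk (hN₂ i).aemeasurable_entries)
    measurable_noisyGram (noiseKernel G' fun w ↦ noisyGram (zeroFill j k w.1, w.2))
    (hp.mono fun z hz ↦ ?_)
  rw [noiseKernel_apply _ hF', map_noise_eq_prod (hN₁ i) (hN₂ i) (hN i)]
  simpa using klDiv_noisyGram_le hz j k (pow_ne_zero 2 hσ₁.ne') (pow_ne_zero 2 hσ₂.ne')
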